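/- Let $n\ge 3$ and let $a,b,\alpha,\beta,\gamma$ be positive real numbers. Let $B^n$ be the open unit ball of $\mathbb R^n$ and $\overline{B^m}$ the closed unit ball of $\mathbb R^m$, and let $|\nabla u(x)|$ denote the operator norm of the derivative of $u$ at $x$ with respect to the Euclidean norms. Consider an open set $D\subset B^n$ and a map $u:D\to\overline{B^m}$ such that (A1) $u$ is of class $C^2$ and $|\Delta u|\le a|\nabla u|^2+b$ on $D$; (A2) there are $\varepsilon>0$ and a real function $G$ of class $C^2$ on $\{p\in\mathbb R^m:|p|\le 1+\varepsilon\}$ with $|\nabla G(p)|\le\alpha$ for $|p|\le 1$, such that $\phi(x)=G(u(x))$ satisfies $\Delta\phi\ge\beta|\nabla u|^2-\gamma$ on $D$. For a constant $c$ consider the estimate $$|\nabla u(x_0)|\le c\left(1+\frac{\sup_{|x-x_0|<r_0}|u(x)-u(x_0)|}{r_0}\right)\quad\text{for all }x_0\in D,\qquad r_0=\operatorname{dist}(x_0,\partial D).\tag{$*$}$$ (i) If $m$, $D$, $u$ satisfy (A1) and (A2) and $u$ moreover extends continuously to $\overline D$ (so that the supremum in $(*)$ equals $\max_{|x-x_0|\le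 r_0}|u(x)-u(x_0)|$), then there is a constant $c>0$, which may depend on $u$ but not on $x_0$, such that $(*)$ holds. (ii) If $$a\le C_n=\frac{(n+1)\sqrt\pi\,\Gamma((n+1)/2)}{8n\,\Gamma(n/2+1)},$$ then there is a constant $c>0$, depending only on $a,b,\alpha,\beta,\gamma,n$, such that $(*)$ holds for all $m$, $D$, $u$ satisfying (A1) and (A2) (without assuming continuity up to the boundary). -/

import Mathlib

open Set

noncomputable section

/-- The critical constant
`C_n = (n + 1) √π Γ((n + 1) / 2) / (8 n Γ(n / 2 + 1))`. -/
def criticalConst (n : ℕ) : ℝ :=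
  ((n : ℝ) + 1) * Real.sqrt Real.pi * Real.Gamma (((n : ℝ) + 1) / 2) /
    (8 * (n : ℝ) * Real.Gamma ((n : ℝ) / 2 + 1))

/-- `u` is a `C²` map of the open set `D`, contained in the open unit ball of `ℝⁿ`,
into the closed unit ball of `ℝᵐ`, and `|Δu| ≤ a |∇u|² + b` on `D`. Here `|∇u(x)|` is the operator
norm of the derivative and `Δ` acts componentwise. -/
structure PoissonInequality {n m : ℕ} (a b : ℝ) (D : Set (EuclideanSpace ℝ (Fin n)))
    (u : EuclideanSpace ℝ (Fin n) → EuclideanSpace ℝ (Fin m)) : Prop where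
  isOpen : IsOpen D
  subset_ball : D ⊆ Metric.ball 0 1
  mapsTo : MapsTo u D (Metric.closedBall 0 1)
  contDiffOn : ContDiffOn ℝ 2 u D
  norm_laplacian_le : ∀ x ∈ D, ‖Laplacian.laplacian u x‖ ≤ a * ‖fderiv ℝ u x‖ ^ 2 + b

/-- There is a real function `G`, of class `C²` on `|p| ≤ 1 + ε` for some `ε > 0`,
with `|∇G| ≤ α` on the closed unit ball (where `u` takes its values), such that `φ = G ∘ u`
satisfies `Δφ ≥ β |∇u|² - γ` on `D`. -/
def HasAuxiliaryFunction {n m : ℕ} (α β γ : ℝ) (D : Set (EuclideanSpace ℝ (Fin n)))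
    (u : EuclideanSpace ℝ (Fin n) → EuclideanSpace ℝ (Fin m)) : Prop :=
  ∃ (ε : ℝ) (G : EuclideanSpace ℝ (Fin m) → ℝ), 0 < ε ∧
    ContDiffOn ℝ 2 G (Metric.closedBall 0 (1 + ε)) ∧
    (∀ p ∈ Metric.closedBall (0 : EuclideanSpace ℝ (Fin m)) 1, ‖fderiv ℝ G p‖ ≤ α) ∧
    ∀ x ∈ D, β * ‖fderiv ℝ u x‖ ^ 2 - γ ≤ Laplacian.laplacian (fun y => G (u y)) x

/-- `sup_{|x - x₀| < r} |u(x) - u(x₀)|`; when `u` is continuous on the closed ball, this is the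
maximum over `|x - x₀| ≤ r`. -/
def oscAt {n m : ℕ} (u : EuclideanSpace ℝ (Fin n) → EuclideanSpace ℝ (Fin m))
    (x₀ : EuclideanSpace ℝ (Fin n)) (r : ℝ) : ℝ :=
  sSup ((fun x => ‖u x - u x₀‖) '' Metric.ball x₀ r)

/-- The interior gradient estimate on `D` with constant `c`: for all `x₀ ∈ D`, with
`r₀ = dist(x₀, ∂D)`, one has
`|∇u(x₀)| ≤ c (1 + sup_{|x - x₀| < r₀} |u(x) - u(x₀)| / r₀)`. -/
def GradientEstimate {n m : ℕ} (c : ℝ) (D : Set (EuclideanSpace ℝ (Fin n)))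
    (u : EuclideanSpace ℝ (Fin n) → EuclideanSpace ℝ (Fin m)) : Prop :=
  ∀ x₀ ∈ D, ‖fderiv ℝ u x₀‖ ≤
    c * (1 + oscAt u x₀ (Metric.infDist x₀ (frontier D)) / Metric.infDist x₀ (frontier D))

end

section

open Laplacian InnerProductSpace Metric Topology Filter

section MaximumPrinciple

variable {E : Type*} [NormedAddCommGroup E] [InnerProductSpace ℝ E]

/-- The second derivative along a line, in terms of the second Fréchet derivative. -/
theorem ContDiffAt.deriv_deriv_line {f : E → ℝ} {x : E} (hf : ContDiffAt ℝ 2 f x) (w : E) :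
    deriv (deriv fun t : ℝ => f (x + t • w)) 0 = fderiv ℝ (fderiv ℝ f) x w w := by
  have hline : ∀ t : ℝ, HasDerivAt (fun t : ℝ => x + t • w) w t := fun t => by
    simpa using ((hasDerivAt_id t).smul_const w).const_add x
  have hev : ∀ᶠ y in 𝓝 x, DifferentiableAt ℝ f y :=
    (hf.eventually (by simp)).mono fun y hy => hy.differentiableAt (by norm_num)
  have hcont : Tendsto (fun t : ℝ => x + t • w) (𝓝 0) (𝓝 x) := by
    simpa using (hline 0).continuousAt.tendsto
  have h1 : deriv (fun t : ℝ => f (x + t • w)) =ᶠ[𝓝 0] fun t => fderiv ℝ f (x + t • w) w := by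
    filter_upwards [hcont.eventually hev] with t ht
    exact (ht.hasFDerivAt.comp_hasDerivAt t (hline t)).deriv
  rw [h1.deriv_eq]
  have h2 : DifferentiableAt ℝ (fderiv ℝ f) x :=
    (hf.fderiv_right (m := 1) (by norm_num)).differentiableAt (by norm_num)
  have h3 : HasDerivAt (fun t : ℝ => fderiv ℝ f (x + t • w)) (fderiv ℝ (fderiv ℝ f) x w) 0 := by
    have h4 : HasFDerivAt (fderiv ℝ f) (fderiv ℝ (fderiv ℝ f) x) (x + (0 : ℝ) • w) := by
      simpa using h2.hasFDerivAt
    exact h4.comp_hasDerivAt (0 : ℝ) (hline 0)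
  exact (h3.clm_apply (hasDerivAt_const (0 : ℝ) w)).deriv.trans (by simp)

/-- The second derivative is nonnegative at an interior minimum. -/
theorem IsLocalMin.deriv_deriv_nonneg {f : ℝ → ℝ} {x : ℝ} (hf : IsLocalMin f x)
    (hc : ContinuousAt f x) : 0 ≤ deriv (deriv f) x := by
  by_contra! h
  have hmax := isLocalMax_of_deriv_deriv_neg h hf.deriv_eq_zero hc
  have hconst : f =ᶠ[𝓝 x] fun _ => f x := by
    filter_upwards [hf, hmax] with y h1 h2 using le_antisymm h2 h1
  have h0 : deriv (deriv f) x = 0 := by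
    rw [hconst.deriv.deriv_eq]
    simp
  exact h.ne h0

theorem IsLocalMin.fderiv_fderiv_nonneg {f : E → ℝ} {x : E} (hf : IsLocalMin f x)
    (h2 : ContDiffAt ℝ 2 f x) (w : E) : 0 ≤ fderiv ℝ (fderiv ℝ f) x w w := by
  rw [← h2.deriv_deriv_line w]
  have hline : ContinuousAt (fun t : ℝ => x + t • w) 0 := by fun_prop
  have hx : x + (0 : ℝ) • w = x := by simp
  refine IsLocalMin.deriv_deriv_nonneg ?_ ?_
  · have := hline.tendsto
    simp only [hx] at this
    filter_upwards [this.eventually hf] with t ht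
    simpa using ht
  · exact ContinuousAt.comp (g := f) (by simpa using h2.continuousAt) hline

variable [FiniteDimensional ℝ E]

theorem IsLocalMin.laplacian_nonneg {f : E → ℝ} {x : E} (hf : IsLocalMin f x)
    (h2 : ContDiffAt ℝ 2 f x) : 0 ≤ (Δ f) x := by
  rw [laplacian_eq_iteratedFDeriv_stdOrthonormalBasis]
  refine Finset.sum_nonneg fun i _ => ?_
  rw [iteratedFDeriv_two_apply]
  exact hf.fderiv_fderiv_nonneg h2 _

theorem laplacian_comp_linearIsometryEquiv {F : Type*} [NormedAddCommGroup F] [NormedSpace ℝ F]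
    (f : E → F) (L : E ≃ₗᵢ[ℝ] E) (x : E) : (Δ (f ∘ L)) x = (Δ f) (L x) := by
  rw [laplacian_eq_iteratedFDeriv_stdOrthonormalBasis,
    laplacian_eq_iteratedFDeriv_orthonormalBasis f ((stdOrthonormalBasis ℝ E).map L)]
  refine Finset.sum_congr rfl fun i _ => ?_
  have h := L.toContinuousLinearEquiv.iteratedFDerivWithin_comp_right f uniqueDiffOn_univ
    (x := x) (mem_univ _) 2
  simp only [preimage_univ, iteratedFDerivWithin_univ] at h
  have h' : iteratedFDeriv ℝ 2 (f ∘ L) x = _ := h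
  rw [h', ContinuousMultilinearMap.compContinuousLinearMap_apply]
  congr 1
  ext j
  fin_cases j <;> simp

theorem laplacian_comp_add_left {F : Type*} [NormedAddCommGroup F] [NormedSpace ℝ F]
    (f : E → F) (a x : E) : (Δ fun y => f (a + y)) x = (Δ f) (a + x) := by
  simp only [laplacian_eq_iteratedFDeriv_stdOrthonormalBasis, iteratedFDeriv_comp_add_left]

theorem laplacian_quadratic (e : E) (c₁ c₂ c₃ : ℝ) (x : E) :
    (Δ fun y : E => c₁ * inner ℝ e y + c₂ * ‖y‖ ^ 2 - c₃ * inner ℝ e y ^ 2) x =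
      2 * Module.finrank ℝ E * c₂ - 2 * c₃ * ‖e‖ ^ 2 := by
  set B : E →L[ℝ] E →L[ℝ] ℝ := innerSL ℝ with hB
  have hi : ∀ y, HasFDerivAt (fun y : E => inner ℝ e y) (B e) y := fun y => (B e).hasFDerivAt
  have h1 : fderiv ℝ (fun y : E => c₁ * inner ℝ e y + c₂ * ‖y‖ ^ 2 - c₃ * inner ℝ e y ^ 2) =
      fun y => c₁ • B e + (2 * c₂) • B y - (2 * c₃ * inner ℝ e y) • B e := by
    ext y w
    have hn : HasFDerivAt (fun y : E => ‖y‖ ^ 2) (2 • B y) y :=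
      (hasStrictFDerivAt_norm_sq y).hasFDerivAt
    have h := (((hi y).const_mul c₁).add (hn.const_mul c₂)).sub (((hi y).pow 2).const_mul c₃)
    have h' : fderiv ℝ (fun y : E => c₁ * inner ℝ e y + c₂ * ‖y‖ ^ 2 - c₃ * inner ℝ e y ^ 2) y = _ :=
      h.fderiv
    rw [h']
    simp
    ring
  have h2 : fderiv ℝ (fun y : E => c₁ • B e + (2 * c₂) • B y - (2 * c₃ * inner ℝ e y) • B e) x =
      (2 * c₂) • B - (2 * c₃) • (B e).smulRight (B e) := by
    have hL : HasFDerivAt (fun y : E => B y) B x := B.hasFDerivAt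
    have h := ((hL.const_smul (2 * c₂)).const_add (c₁ • B e)).sub
      (((hi x).const_mul (2 * c₃)).smul_const (B e))
    have h' : fderiv ℝ (fun y : E => c₁ • B e + (2 * c₂) • B y - (2 * c₃ * inner ℝ e y) • B e) x = _ :=
      h.fderiv
    rw [h']
    ext y w
    simp
    ring
  rw [laplacian_eq_iteratedFDeriv_stdOrthonormalBasis]
  simp only [iteratedFDeriv_two_apply, h1, h2]
  have hs := (stdOrthonormalBasis ℝ E).sum_sq_norm_inner_right e
  simp only [Real.norm_eq_abs, sq_abs] at hs
  rw [← hs, Finset.mul_sum]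
  have hBi : ∀ y w, B y w = inner ℝ y w := fun y w => rfl
  simp [Finset.sum_sub_distrib, real_inner_comm, pow_two, hBi]
  ring_nf

/-- Interior gradient estimate for Poisson's equation, by comparison of the odd part of `v` with a
quadratic barrier. -/
theorem fderiv_apply_le_of_abs_laplacian_lt {v : E → ℝ} {K F h R : ℝ} {e : E}
    (he : ‖e‖ = 1) (hh : 0 < h) (hR : 0 < R)
    (hv : ∀ x ∈ closedBall (0 : E) R, ContDiffAt ℝ 2 v x)
    (hK : ∀ x ∈ closedBall (0 : E) R, |v x| ≤ K)
    (hF : ∀ x ∈ closedBall (0 : E) R, |(Δ v) x| < F) :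
    fderiv ℝ v 0 e ≤ K / h + K * Module.finrank ℝ E * h / R ^ 2 + F * h / 2 := by
  set N : ℝ := (Module.finrank ℝ E : ℝ) with hN
  have hN0 : 0 ≤ N := by positivity
  have h0mem : (0 : E) ∈ closedBall (0 : E) R := by simp [hR.le]
  have hK0 : 0 ≤ K := (abs_nonneg _).trans (hK 0 h0mem)
  have hF0 : 0 < F := (abs_nonneg _).trans_lt (hF 0 h0mem)
  set L : E ≃ₗᵢ[ℝ] E := (ℝ ∙ e)ᗮ.reflection with hL
  have hLe : L e = -e := Submodule.reflection_orthogonalComplement_singleton_eq_neg e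
  have hLball : ∀ x ∈ closedBall (0 : E) R, L x ∈ closedBall (0 : E) R := by
    intro x hx
    simpa using hx
  set c₁ := K / h + K * N * h / R ^ 2 + F * h / 2 with hc₁
  set c₂ := K / R ^ 2 with hc₂
  set c₃ := K * N / R ^ 2 + F / 2 with hc₃
  have hc₂0 : 0 ≤ c₂ := by positivity
  have hc₃0 : 0 ≤ c₃ := by positivity
  set ψ : E → ℝ := fun y => c₁ * inner ℝ e y + c₂ * ‖y‖ ^ 2 - c₃ * inner ℝ e y ^ 2 with hψ
  set g : E → ℝ := ψ - (1 / 2 : ℝ) • (v - v ∘ L) with hg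
  have hψ2 : ContDiff ℝ 2 ψ := by
    have h1 : ContDiff ℝ 2 fun y : E => ‖y‖ ^ 2 := contDiff_norm_sq ℝ
    have h2 : ContDiff ℝ 2 fun y : E => inner ℝ e y := (innerSL ℝ e).contDiff
    exact ((contDiff_const.mul h2).add (contDiff_const.mul h1)).sub
      (contDiff_const.mul (h2.pow 2))
  have hvL : ∀ x ∈ closedBall (0 : E) R, ContDiffAt ℝ 2 (v ∘ L) x := fun x hx =>
    (hv _ (hLball x hx)).comp x L.contDiff.contDiffAt
  have hw2 : ∀ x ∈ closedBall (0 : E) R, ContDiffAt ℝ 2 (v - v ∘ L) x := fun x hx =>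
    (hv x hx).sub (hvL x hx)
  have hw2' : ∀ x ∈ closedBall (0 : E) R, ContDiffAt ℝ 2 ((1 / 2 : ℝ) • (v - v ∘ L)) x :=
    fun x hx => (hw2 x hx).const_smul (1 / 2 : ℝ)
  have hg2 : ∀ x ∈ closedBall (0 : E) R, ContDiffAt ℝ 2 g x := fun x hx =>
    hψ2.contDiffAt.sub (hw2' x hx)
  have hψeq : ∀ x, ψ x = K * (inner ℝ e x / h) + K * (‖x‖ ^ 2 / R ^ 2) +
      c₃ * (inner ℝ e x * (h - inner ℝ e x)) := by
    intro x
    simp only [hψ, hc₁, hc₂, hc₃]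
    field_simp
    ring
  have hodd : ∀ x ∈ closedBall (0 : E) R, (1 / 2 : ℝ) * (v x - v (L x)) ≤ K := by
    intro x hx
    have h1 := abs_le.1 (hK x hx)
    have h2 := abs_le.1 (hK _ (hLball x hx))
    linarith [h1.2, h2.1]
  have hgx : ∀ x, g x = ψ x - (1 / 2 : ℝ) * (v x - v (L x)) := fun x => by simp [hg]
  have hlap : ∀ x ∈ closedBall (0 : E) R, (Δ g) x < 0 := by
    intro x hx
    rw [hg, ContDiffAt.laplacian_sub hψ2.contDiffAt (hw2' x hx),
      laplacian_smul _ (hw2 x hx), ContDiffAt.laplacian_sub (hv x hx) (hvL x hx),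
      laplacian_comp_linearIsometryEquiv, hψ, laplacian_quadratic, he]
    have h1 := abs_lt.1 (hF x hx)
    have h2 := abs_lt.1 (hF _ (hLball x hx))
    have h3 : 2 * N * c₂ - 2 * c₃ * 1 ^ 2 = -F := by
      simp only [hc₂, hc₃]
      ring
    rw [← hN, h3, smul_eq_mul]
    linarith [h1.1, h2.2]
  -- the comparison domain
  set S : Set E := {x | 0 ≤ inner ℝ e x ∧ inner ℝ e x ≤ h} ∩ closedBall 0 R with hS
  have hie : Continuous fun x : E => inner ℝ e x := by fun_prop
  have hScomp : IsCompact S := by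
    refine (isCompact_closedBall (0 : E) R).inter_left ?_
    exact (isClosed_le continuous_const hie).inter (isClosed_le hie continuous_const)
  have hS0 : (0 : E) ∈ S := ⟨by simp [hh.le], h0mem⟩
  have hgc : ContinuousOn g S := fun x hx => (hg2 x hx.2).continuousAt.continuousWithinAt
  have hnonneg : ∀ x ∈ S, 0 ≤ g x := by
    obtain ⟨x, hx, hmin⟩ := hScomp.exists_isMinOn ⟨0, hS0⟩ hgc
    suffices 0 ≤ g x from fun y hy => this.trans (hmin hy)
    have ht0 := hx.1.1
    have hth := hx.1.2
    have hxR : ‖x‖ ≤ R := by simpa using hx.2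
    have hbound : K ≤ ψ x → 0 ≤ g x := fun hk => by
      rw [hgx]
      linarith [hodd x hx.2]
    have hprod : 0 ≤ c₃ * (inner ℝ e x * (h - inner ℝ e x)) :=
      mul_nonneg hc₃0 (mul_nonneg ht0 (sub_nonneg.2 hth))
    rcases ht0.eq_or_lt with ht | ht
    · have hLx : L x = x := by
        refine Submodule.reflection_mem_subspace_eq_self ?_
        exact Submodule.mem_orthogonal_singleton_iff_inner_right.2 ht.symm
      rw [hgx, hLx, hψeq, ← ht]
      simp
      positivity
    rcases hth.eq_or_lt with hth' | hth'
    · refine hbound ?_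
      rw [hψeq, hth', div_self hh.ne']
      have : 0 ≤ K * (‖x‖ ^ 2 / R ^ 2) := by positivity
      simpa using this
    rcases hxR.eq_or_lt with hxR' | hxR'
    · refine hbound ?_
      rw [hψeq, hxR', div_self (by positivity)]
      have : 0 ≤ K * (inner ℝ e x / h) := by positivity
      linarith
    · exfalso
      have hSx : S ∈ 𝓝 x := by
        have h1 : {y : E | 0 < inner ℝ e y} ∈ 𝓝 x := (isOpen_lt continuous_const hie).mem_nhds ht
        have h2 : {y : E | inner ℝ e y < h} ∈ 𝓝 x := (isOpen_lt hie continuous_const).mem_nhds hth'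
        have h3 : closedBall (0 : E) R ∈ 𝓝 x :=
          mem_of_superset (isOpen_ball.mem_nhds (by simpa using hxR')) ball_subset_closedBall
        filter_upwards [h1, h2, h3] with y hy1 hy2 hy3 using ⟨⟨hy1.le, hy2.le⟩, hy3⟩
      exact absurd ((hmin.isLocalMin hSx).laplacian_nonneg (hg2 x hx.2)) (hlap x hx.2).not_ge
  -- the derivative of `g` in direction `e` at the origin is nonnegative
  have hdv : HasFDerivAt v (fderiv ℝ v 0) 0 :=
    ((hv 0 h0mem).differentiableAt (by norm_num)).hasFDerivAt
  have hline : ∀ w : E, HasDerivAt (fun t : ℝ => t • w) w 0 := fun w => by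
    simpa using (hasDerivAt_id (0 : ℝ)).smul_const w
  have hvline : ∀ w : E, HasDerivAt (fun t : ℝ => v (t • w)) (fderiv ℝ v 0 w) 0 := fun w =>
    HasFDerivAt.comp_hasDerivAt (0 : ℝ) (show HasFDerivAt v (fderiv ℝ v 0) ((0 : ℝ) • w) by
      simpa using hdv) (hline w)
  have hgline : (fun t : ℝ => g (t • e)) = fun t : ℝ =>
      c₁ * t + (c₂ - c₃) * t ^ 2 - (1 / 2 : ℝ) * (v (t • e) - v (t • (-e))) := by
    funext t
    rw [hgx, map_smul, hLe]
    simp only [hψ, inner_smul_right, norm_smul, real_inner_self_eq_norm_sq, he, Real.norm_eq_abs,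
      mul_one, one_pow, sq_abs]
    ring
  have hder : HasDerivAt (fun t : ℝ => g (t • e)) (c₁ - fderiv ℝ v 0 e) 0 := by
    rw [hgline]
    have := (((hasDerivAt_id (0 : ℝ)).const_mul c₁).add
      (((hasDerivAt_id (0 : ℝ)).pow 2).const_mul (c₂ - c₃))).sub
      (((hvline e).sub (hvline (-e))).const_mul (1 / 2 : ℝ))
    refine this.congr_deriv ?_
    simp
    ring
  have hge : ∀ᶠ t : ℝ in 𝓝[>] 0, 0 ≤ g (t • e) := by
    have : Ioo (0 : ℝ) (min h R) ∈ 𝓝[>] (0 : ℝ) := Ioo_mem_nhdsGT (lt_min hh hR)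
    filter_upwards [this] with t ht
    have ht1 := (lt_min_iff.1 ht.2).1
    have ht2 := (lt_min_iff.1 ht.2).2
    refine hnonneg _ ⟨?_, ?_⟩
    · simp only [mem_ofPred_eq, inner_smul_right, real_inner_self_eq_norm_sq, he]
      constructor <;> nlinarith [ht.1]
    · simpa [norm_smul, he, abs_of_pos ht.1] using ht2.le
  have hslope := (hasDerivAt_iff_tendsto_slope.1 hder).mono_left
    (nhdsWithin_mono (0 : ℝ) (show Ioi (0 : ℝ) ⊆ {0}ᶜ from fun t ht => ne_of_gt ht))
  have hfin : 0 ≤ c₁ - fderiv ℝ v 0 e := by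
    refine ge_of_tendsto hslope ?_
    filter_upwards [hge, self_mem_nhdsWithin] with t ht ht0
    have hg0 : g ((0 : ℝ) • e) = 0 := by simp [hgx, hψ]
    rw [slope_def_field, hg0, sub_zero, sub_zero]
    exact div_nonneg ht (le_of_lt ht0)
  linarith

end MaximumPrinciple

section Bernstein

variable {E F : Type*} [NormedAddCommGroup E] [InnerProductSpace ℝ E] [FiniteDimensional ℝ E]
  [NormedAddCommGroup F] [InnerProductSpace ℝ F]

/-- Interior gradient estimate for Poisson's equation, for vector-valued maps. -/
theorem norm_fderiv_le_of_norm_laplacian_le {u : E → F} {c : F} {x₀ : E} {K A h R : ℝ}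
    (hh : 0 < h) (hR : 0 < R)
    (hu : ∀ x ∈ closedBall x₀ R, ContDiffAt ℝ 2 u x)
    (hK : ∀ x ∈ closedBall x₀ R, ‖u x - c‖ ≤ K)
    (hA : ∀ x ∈ closedBall x₀ R, ‖(Δ u) x‖ ≤ A) :
    ‖fderiv ℝ u x₀‖ ≤ K / h + K * Module.finrank ℝ E * h / R ^ 2 + A * h / 2 := by
  have hx₀ : x₀ ∈ closedBall x₀ R := mem_closedBall_self hR.le
  have hK0 : 0 ≤ K := (norm_nonneg _).trans (hK x₀ hx₀)
  have hA0 : 0 ≤ A := (norm_nonneg _).trans (hA x₀ hx₀)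
  have hmem : ∀ y ∈ closedBall (0 : E) R, x₀ + y ∈ closedBall x₀ R := by
    intro y hy
    simpa using hy
  have key : ∀ (e : E) (ξ : F), ‖e‖ = 1 → ‖ξ‖ = 1 →
      inner ℝ ξ (fderiv ℝ u x₀ e) ≤
        K / h + K * Module.finrank ℝ E * h / R ^ 2 + A * h / 2 := by
    intro e ξ he hξ
    set w : E → F := u - fun _ => c with hw
    have hw2 : ∀ x ∈ closedBall x₀ R, ContDiffAt ℝ 2 w x := fun x hx =>
      (hu x hx).sub contDiffAt_const
    have hwt : ∀ y ∈ closedBall (0 : E) R, ContDiffAt ℝ 2 (fun y => w (x₀ + y)) y := fun y hy =>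
      (hw2 _ (hmem y hy)).comp y (contDiffAt_const.add contDiffAt_id)
    set v : E → ℝ := innerSL ℝ ξ ∘ fun y => w (x₀ + y) with hv
    have hv2 : ∀ y ∈ closedBall (0 : E) R, ContDiffAt ℝ 2 v y := fun y hy =>
      (innerSL ℝ ξ).contDiff.contDiffAt.comp y (hwt y hy)
    have hdv : fderiv ℝ v 0 e = inner ℝ ξ (fderiv ℝ u x₀ e) := by
      have h1 : HasFDerivAt w (fderiv ℝ u x₀) (x₀ + 0) := by
        rw [add_zero]
        exact ((hu x₀ hx₀).differentiableAt (by norm_num)).hasFDerivAt.sub_const c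
      have h2 : HasFDerivAt (fun y : E => x₀ + y) (ContinuousLinearMap.id ℝ E) 0 :=
        (hasFDerivAt_id (0 : E)).const_add x₀
      have h3 : fderiv ℝ v 0 = _ :=
        ((innerSL ℝ ξ).hasFDerivAt.comp (0 : E) (h1.comp (0 : E) h2)).fderiv
      rw [h3]
      simp
    rw [← hdv]
    refine le_of_forall_pos_le_add fun ε hε => ?_
    have hest := fderiv_apply_le_of_abs_laplacian_lt (v := v) (K := K) (F := A + 2 * ε / h) he hh hR
      hv2 ?_ ?_
    · refine hest.trans (le_of_eq ?_)
      field_simp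
      ring
    · intro y hy
      have := abs_real_inner_le_norm ξ (w (x₀ + y))
      rw [hξ, one_mul] at this
      exact this.trans (hK _ (hmem y hy))
    · intro y hy
      have h1 : (Δ v) y = inner ℝ ξ ((Δ u) (x₀ + y)) := by
        rw [hv, (hwt y hy).laplacian_CLM_comp_left, Function.comp_apply, laplacian_comp_add_left, hw,
          ContDiffAt.laplacian_sub (hu _ (hmem y hy)) contDiffAt_const, laplacian_const]
        simp
      rw [h1]
      have h2 := abs_real_inner_le_norm ξ ((Δ u) (x₀ + y))
      rw [hξ, one_mul] at h2
      have h3 : 0 < 2 * ε / h := by positivity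
      linarith [hA _ (hmem y hy)]
  set C := K / h + K * Module.finrank ℝ E * h / R ^ 2 + A * h / 2 with hC
  have hC0 : 0 ≤ C := by positivity
  refine ContinuousLinearMap.opNorm_le_of_unit_norm hC0 fun e he => ?_
  by_cases hz : fderiv ℝ u x₀ e = 0
  · simpa [hz] using hC0
  have hz' : ‖fderiv ℝ u x₀ e‖ ≠ 0 := norm_ne_zero_iff.2 hz
  have := key e (‖fderiv ℝ u x₀ e‖⁻¹ • fderiv ℝ u x₀ e) he (by
    rw [norm_smul, norm_inv, norm_norm, inv_mul_cancel₀ hz'])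
  rw [real_inner_smul_left, real_inner_self_eq_norm_sq, pow_two, inv_mul_cancel_left₀ hz'] at this
  exact this

/-- If the weighted gradient `(ρ - |x - x₀|) |f x|` exceeds `N` on some ball, it is maximal with value
`N` at some point of a smaller ball. -/
theorem exists_weighted_max_eq {G : Type*} [NormedAddCommGroup G] {f : E → G} {x₀ : E} {r N : ℝ}
    (hr : 0 < r) (hN : 0 < N) (hf : ContinuousOn f (closedBall x₀ r)) (h : N ≤ r * ‖f x₀‖) :
    ∃ ρ x₁, ρ ≤ r ∧ dist x₁ x₀ < ρ ∧ (ρ - dist x₁ x₀) * ‖f x₁‖ = N ∧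
      ∀ y ∈ ball x₀ ρ, (ρ - dist y x₀) * ‖f y‖ ≤ N := by
  set B : Set (ℝ × E) := Icc 0 r ×ˢ closedBall x₀ r with hB
  have hBc : IsCompact B := isCompact_Icc.prod (isCompact_closedBall x₀ r)
  have hcont : ContinuousOn (fun p : ℝ × E => (p.1 - dist p.2 x₀) * ‖f p.2‖) B := by
    have h1 : ContinuousOn (fun p : ℝ × E => f p.2) B :=
      hf.comp continuousOn_snd fun p hp => hp.2
    exact ContinuousOn.mul (by fun_prop) h1.norm
  set T : Set (ℝ × E) := B ∩ (fun p : ℝ × E => (p.1 - dist p.2 x₀) * ‖f p.2‖) ⁻¹' Ici N with hT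
  have hTc : IsCompact T :=
    hBc.of_isClosed_subset (hcont.preimage_isClosed_of_isClosed hBc.isClosed isClosed_Ici)
      inter_subset_left
  have hTne : T.Nonempty :=
    ⟨(r, x₀), ⟨⟨⟨hr.le, le_rfl⟩, mem_closedBall_self hr.le⟩, by simpa using h⟩⟩
  obtain ⟨⟨ρ, x₁⟩, ⟨⟨hρ, hx₁⟩, hge⟩, hmin⟩ := hTc.exists_isMinOn hTne continuous_fst.continuousOn
  simp only [mem_preimage, mem_Ici] at hge
  have hd : dist x₁ x₀ < ρ := by
    by_contra! hcon
    exact absurd (mul_nonpos_of_nonpos_of_nonneg (sub_nonpos.2 hcon) (norm_nonneg (f x₁)))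
      (not_le.2 (hN.trans_le hge))
  have hmax : ∀ y ∈ ball x₀ ρ, (ρ - dist y x₀) * ‖f y‖ ≤ N := by
    intro y hy
    rw [mem_ball] at hy
    by_contra! hcon
    have hfy : 0 < ‖f y‖ := by
      rcases (norm_nonneg (f y)).eq_or_lt with h0 | h0
      · rw [← h0, mul_zero] at hcon
        exact absurd hcon hN.not_gt
      · exact h0
    have hlt : N / ‖f y‖ < ρ - dist y x₀ := (div_lt_iff₀ hfy).2 hcon
    have hpos : 0 < N / ‖f y‖ := div_pos hN hfy
    have hdy : 0 ≤ dist y x₀ := dist_nonneg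
    have hmem : (dist y x₀ + N / ‖f y‖, y) ∈ T := by
      refine ⟨⟨⟨by positivity, by linarith [hρ.2]⟩, mem_closedBall.2 (by linarith [hρ.2])⟩, ?_⟩
      simp only [mem_preimage, mem_Ici, add_sub_cancel_left]
      rw [div_mul_cancel₀ _ hfy.ne']
    have : ρ ≤ dist y x₀ + N / ‖f y‖ := hmin hmem
    linarith
  exact ⟨ρ, x₁, hρ.2, hd, le_antisymm (hmax x₁ (mem_ball.2 hd)) hge, hmax⟩

/-- A gap in the values which the weighted maximum of the gradient can take bounds the gradient. -/
theorem mul_norm_fderiv_le_of_gap {u : E → F} {c : F} {x₀ : E} {a b r K N κ θ : ℝ}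
    (ha : 0 ≤ a) (hb : 0 ≤ b) (hN : 0 < N) (hκ : 0 < κ) (hθ : 0 < θ) (hθ1 : θ < 1)
    (hu : ∀ x ∈ ball x₀ r, ContDiffAt ℝ 2 u x)
    (hK : ∀ x ∈ ball x₀ r, ‖u x - c‖ ≤ K)
    (hlap : ∀ x ∈ ball x₀ r, ‖(Δ u) x‖ ≤ a * ‖fderiv ℝ u x‖ ^ 2 + b)
    (hgap : K / κ + K * Module.finrank ℝ E * κ / θ ^ 2
      + (a * N ^ 2 / (1 - θ) ^ 2 + b * r ^ 2) * κ / 2 < N) :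
    r * ‖fderiv ℝ u x₀‖ ≤ N := by
  by_contra! hcon
  have hD : 0 < ‖fderiv ℝ u x₀‖ := by
    rcases (norm_nonneg (fderiv ℝ u x₀)).eq_or_lt with h0 | h0
    · rw [← h0, mul_zero] at hcon
      exact absurd hcon hN.not_gt
    · exact h0
  obtain ⟨s, hs1, hs2⟩ := exists_between ((div_lt_iff₀ hD).2 hcon)
  have hs0 : 0 < s := (div_pos hN hD).trans hs1
  have hsr : closedBall x₀ s ⊆ ball x₀ r := closedBall_subset_ball hs2
  have hfd : ContinuousOn (fderiv ℝ u) (closedBall x₀ s) := fun x hx =>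
    ((hu x (hsr hx)).fderiv_right (m := 1) (by norm_num)).continuousAt.continuousWithinAt
  obtain ⟨ρ, x₁, hρ, hx₁, heq, hmax⟩ :=
    exists_weighted_max_eq hs0 hN hfd ((div_lt_iff₀ hD).1 hs1).le
  set d := ρ - dist x₁ x₀ with hd
  have hd0 : 0 < d := sub_pos.2 hx₁
  have hdr : d ≤ r := by linarith [dist_nonneg (x := x₁) (y := x₀)]
  have h1θ : 0 < 1 - θ := sub_pos.2 hθ1
  have hdist : ∀ y ∈ closedBall x₁ (θ * d), dist y x₀ ≤ ρ - (1 - θ) * d := by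
    intro y hy
    have := dist_triangle y x₁ x₀
    rw [mem_closedBall] at hy
    linarith
  have hin : ∀ y ∈ closedBall x₁ (θ * d), y ∈ ball x₀ ρ := fun y hy => by
    rw [mem_ball]
    linarith [hdist y hy, mul_pos h1θ hd0]
  have hin' : ∀ y ∈ closedBall x₁ (θ * d), y ∈ ball x₀ r := fun y hy =>
    ball_subset_ball (hρ.trans hs2.le) (hin y hy)
  have hgrad : ∀ y ∈ closedBall x₁ (θ * d), ‖fderiv ℝ u y‖ ≤ N / ((1 - θ) * d) := by
    intro y hy
    rw [le_div_iff₀ (mul_pos h1θ hd0), mul_comm]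
    refine le_trans ?_ (hmax y (hin y hy))
    gcongr
    linarith [hdist y hy]
  have hest := norm_fderiv_le_of_norm_laplacian_le (u := u) (c := c) (x₀ := x₁) (K := K)
    (A := a * (N / ((1 - θ) * d)) ^ 2 + b) (mul_pos hκ hd0) (mul_pos hθ hd0)
    (fun y hy => hu y (hin' y hy)) (fun y hy => hK y (hin' y hy))
    (fun y hy => (hlap y (hin' y hy)).trans (by gcongr; exact hgrad y hy))
  have h2 := mul_le_mul_of_nonneg_left hest hd0.le
  rw [heq] at h2
  have h3 : d * (K / (κ * d) + K * Module.finrank ℝ E * (κ * d) / (θ * d) ^ 2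
      + (a * (N / ((1 - θ) * d)) ^ 2 + b) * (κ * d) / 2) =
      K / κ + K * Module.finrank ℝ E * κ / θ ^ 2
        + (a * N ^ 2 / (1 - θ) ^ 2 + b * d ^ 2) * κ / 2 := by
    field_simp
  rw [h3] at h2
  have h4 : (a * N ^ 2 / (1 - θ) ^ 2 + b * d ^ 2) * κ / 2 ≤
      (a * N ^ 2 / (1 - θ) ^ 2 + b * r ^ 2) * κ / 2 := by gcongr
  linarith

theorem mul_norm_fderiv_le_of_small_coeff {u : E → F} {x₀ : E} {a b r : ℝ}
    (ha : 0 ≤ a) (ha' : a ≤ 3 / 10) (hb : 0 ≤ b) (hr : 0 ≤ r) (hr2 : r ≤ 2)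
    (hu : ∀ x ∈ ball x₀ r, ContDiffAt ℝ 2 u x)
    (hK : ∀ x ∈ ball x₀ r, ‖u x‖ ≤ 1)
    (hlap : ∀ x ∈ ball x₀ r, ‖(Δ u) x‖ ≤ a * ‖fderiv ℝ u x‖ ^ 2 + b) :
    r * ‖fderiv ℝ u x₀‖ ≤ 1300 * (Module.finrank ℝ E + 1) + 40 * b := by
  set n : ℝ := (Module.finrank ℝ E : ℝ) with hn
  have hn0 : 0 ≤ n := by positivity
  set N : ℝ := 1300 * (n + 1) + 40 * b with hN
  have hN0 : 0 < N := by positivity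
  have hN1 : 1 ≤ N := by linarith
  refine mul_norm_fderiv_le_of_gap (c := (0 : F)) (K := 1) (κ := 2 / N) (θ := 1 / 8) ha hb hN0
    (by positivity) (by norm_num) (by norm_num) hu (by simpa using hK) hlap ?_
  rw [← hn]
  have h1 : 1 / (2 / N) + 1 * n * (2 / N) / (1 / 8) ^ 2
      + (a * N ^ 2 / (1 - 1 / 8) ^ 2 + b * r ^ 2) * (2 / N) / 2 =
      (N ^ 2 / 2 + 128 * n + 64 / 49 * a * N ^ 2 + b * r ^ 2) / N := by
    field_simp
    ring
  rw [h1, div_lt_iff₀ hN0]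
  have h2 : N ≤ N ^ 2 := by nlinarith
  have h3 : a * N ^ 2 ≤ 3 / 10 * N ^ 2 := by gcongr
  have h4 : b * r ^ 2 ≤ b * 2 ^ 2 := by gcongr
  nlinarith

theorem mul_norm_fderiv_le_of_small_osc {u : E → F} {x₀ : E} {a b r K Λ : ℝ}
    (ha : 0 < a) (hb : 0 ≤ b) (hr : 0 < r) (hr2 : r ≤ 2) (hK0 : 0 ≤ K)
    (hΛ : Λ = 4 * Module.finrank ℝ E + 3 + b) (hsmall : 2 * a * Λ ^ 2 * (r + K) ≤ 1)
    (hu : ∀ x ∈ ball x₀ r, ContDiffAt ℝ 2 u x)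
    (hK : ∀ x ∈ ball x₀ r, ‖u x - u x₀‖ ≤ K)
    (hlap : ∀ x ∈ ball x₀ r, ‖(Δ u) x‖ ≤ a * ‖fderiv ℝ u x‖ ^ 2 + b) :
    r * ‖fderiv ℝ u x₀‖ ≤ Λ * (r + K) := by
  set n : ℝ := (Module.finrank ℝ E : ℝ) with hn
  have hn0 : 0 ≤ n := by positivity
  have hΛ0 : 0 < Λ := by rw [hΛ]; positivity
  set k := r + K with hk
  have hk0 : 0 < k := by positivity
  refine mul_norm_fderiv_le_of_gap (c := u x₀) (K := k) (κ := 1) (θ := 1 / 2) ha.le hb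
    (by positivity) one_pos (by norm_num) (by norm_num) hu
    (fun x hx => (hK x hx).trans (by linarith)) hlap ?_
  rw [← hn]
  have h1 : b * r ^ 2 ≤ b * (2 * k) := by
    gcongr
    nlinarith
  have h2 : 2 * a * Λ ^ 2 * k * k ≤ 1 * k := by gcongr
  have h3 : k / 1 + k * n * 1 / (1 / 2) ^ 2
      + (a * (Λ * k) ^ 2 / (1 - 1 / 2) ^ 2 + b * r ^ 2) * 1 / 2 =
      k + 4 * n * k + 2 * a * Λ ^ 2 * k * k + b * r ^ 2 / 2 := by ring
  have h4 : Λ * k = 4 * n * k + 3 * k + b * k := by rw [hΛ]; ring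
  rw [h3, h4]
  linarith

end Bernstein

theorem criticalConst_le {n : ℕ} (hn : 3 ≤ n) : criticalConst n ≤ 3 / 10 := by
  have hn' : (3 : ℝ) ≤ n := by exact_mod_cast hn
  have hG : Real.Gamma (((n : ℝ) + 1) / 2) ≤ Real.Gamma ((n : ℝ) / 2 + 1) :=
    Real.Gamma_strictMonoOn_Ici.monotoneOn (by simp only [mem_Ici]; linarith)
      (by simp only [mem_Ici]; linarith) (by linarith)
  have hG0 : 0 < Real.Gamma ((n : ℝ) / 2 + 1) := Real.Gamma_pos_of_pos (by positivity)
  have hpi : Real.sqrt Real.pi ≤ 1.8 := by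
    rw [Real.sqrt_le_left (by norm_num)]
    linarith [Real.pi_lt_d2]
  rw [criticalConst, div_le_iff₀ (by positivity)]
  calc ((n : ℝ) + 1) * Real.sqrt Real.pi * Real.Gamma (((n : ℝ) + 1) / 2)
      ≤ ((n : ℝ) + 1) * 1.8 * Real.Gamma ((n : ℝ) / 2 + 1) := by gcongr
    _ ≤ (3 / 10 * (8 * n)) * Real.Gamma ((n : ℝ) / 2 + 1) :=
        mul_le_mul_of_nonneg_right (by linarith) hG0.le
    _ = _ := by ring

section Domain

variable {n m : ℕ} {a b : ℝ} {D : Set (EuclideanSpace ℝ (Fin n))}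
  {u : EuclideanSpace ℝ (Fin n) → EuclideanSpace ℝ (Fin m)} {x₀ : EuclideanSpace ℝ (Fin n)}

theorem frontier_nonempty_of_subset_unit_ball (hn : 0 < n) (hD : D ⊆ ball 0 1) (hx₀ : x₀ ∈ D) :
    (frontier D).Nonempty := by
  rw [nonempty_frontier_iff]
  refine ⟨⟨x₀, hx₀⟩, fun h => ?_⟩
  have h1 : EuclideanSpace.single (⟨0, hn⟩ : Fin n) (1 : ℝ) ∈ D := h ▸ mem_univ _
  simpa using hD h1

theorem infDist_frontier_pos (hn : 0 < n) (hDo : IsOpen D) (hD : D ⊆ ball 0 1) (hx₀ : x₀ ∈ D) :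
    0 < infDist x₀ (frontier D) := by
  rw [← isClosed_frontier.notMem_iff_infDist_pos (frontier_nonempty_of_subset_unit_ball hn hD hx₀)]
  exact fun h => (hDo.inter_frontier_eq ▸ ⟨hx₀, h⟩ : x₀ ∈ (∅ : Set _))

theorem infDist_frontier_le_two (hn : 0 < n) (hD : D ⊆ ball 0 1) (hx₀ : x₀ ∈ D) :
    infDist x₀ (frontier D) ≤ 2 := by
  obtain ⟨y, hy⟩ := frontier_nonempty_of_subset_unit_ball hn hD hx₀
  have hy1 : y ∈ closedBall 0 1 :=
    closure_ball_subset_closedBall (closure_mono hD (frontier_subset_closure hy))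
  have h1 := mem_ball.1 (hD hx₀)
  have h2 := mem_closedBall.1 hy1
  linarith [infDist_le_dist_of_mem (x := x₀) hy, dist_triangle_right x₀ y 0]

theorem ball_infDist_frontier_subset (hDo : IsOpen D) (hx₀ : x₀ ∈ D) :
    ball x₀ (infDist x₀ (frontier D)) ⊆ D := by
  rcases le_or_gt (infDist x₀ (frontier D)) 0 with h | h
  · simp [ball_eq_empty.2 h]
  refine (convex_ball x₀ _).isPreconnected.subset_of_closure_inter_subset hDo
    ⟨x₀, mem_ball_self h, hx₀⟩ ?_
  rintro y ⟨hy1, hy2⟩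
  by_contra hy
  have : y ∈ frontier D := ⟨hy1, by rwa [hDo.interior_eq]⟩
  rw [mem_ball, dist_comm] at hy2
  exact absurd (infDist_le_dist_of_mem this) hy2.not_ge

theorem oscAt_nonneg (r : ℝ) : 0 ≤ oscAt u x₀ r :=
  Real.sSup_nonneg (by rintro _ ⟨x, -, rfl⟩; exact norm_nonneg _)

theorem norm_sub_le_oscAt (hu : MapsTo u D (closedBall 0 1)) (hx₀ : x₀ ∈ D) {r : ℝ}
    (hr : ball x₀ r ⊆ D) {x : EuclideanSpace ℝ (Fin n)} (hx : x ∈ ball x₀ r) :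
    ‖u x - u x₀‖ ≤ oscAt u x₀ r := by
  refine le_csSup ⟨2, ?_⟩ (mem_image_of_mem _ hx)
  rintro _ ⟨y, hy, rfl⟩
  have h1 := mem_closedBall_zero_iff.1 (hu (hr hy))
  have h2 := mem_closedBall_zero_iff.1 (hu hx₀)
  exact (norm_sub_le _ _).trans (by linarith)

theorem PoissonInequality.contDiffAt (h : PoissonInequality a b D u) (hx₀ : x₀ ∈ D) :
    ContDiffAt ℝ 2 u x₀ :=
  h.contDiffOn.contDiffAt (h.isOpen.mem_nhds hx₀)

/-- The interior gradient estimate on balls on which the oscillation is small. -/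
theorem PoissonInequality.mul_norm_fderiv_le (h : PoissonInequality a b D u) (ha : 0 < a)
    (hb : 0 ≤ b) {r K Λ : ℝ} (hr : 0 < r) (hr2 : r ≤ 2) (hrD : ball x₀ r ⊆ D) (hK0 : 0 ≤ K)
    (hK : ∀ x ∈ ball x₀ r, ‖u x - u x₀‖ ≤ K) (hΛ : Λ = 4 * n + 3 + b)
    (hsmall : 2 * a * Λ ^ 2 * (r + K) ≤ 1) :
    r * ‖fderiv ℝ u x₀‖ ≤ Λ * (r + K) :=
  mul_norm_fderiv_le_of_small_osc ha hb hr hr2 hK0 (by simpa using hΛ) hsmall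
    (fun x hx => h.contDiffAt (hrD hx)) hK (fun x hx => h.norm_laplacian_le x (hrD hx))

theorem GradientEstimate.of_mul_le {c : ℝ} (hpos : ∀ x₀ ∈ D, 0 < infDist x₀ (frontier D))
    (h : ∀ x₀ ∈ D, infDist x₀ (frontier D) * ‖fderiv ℝ u x₀‖ ≤
      c * (infDist x₀ (frontier D) + oscAt u x₀ (infDist x₀ (frontier D)))) :
    GradientEstimate c D u := by
  intro x₀ hx₀
  have h0 := hpos x₀ hx₀
  have h1 := h x₀ hx₀
  rw [mul_comm, ← le_div_iff₀ h0, mul_div_assoc, add_div, div_self h0.ne'] at h1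
  exact h1

/-- The gradient estimate for maps which are continuous up to the boundary. -/
theorem PoissonInequality.exists_gradientEstimate (h : PoissonInequality a b D u) (hn : 0 < n)
    (ha : 0 < a) (hb : 0 ≤ b) (hu : ContinuousOn u (closure D)) :
    ∃ c : ℝ, 0 < c ∧ GradientEstimate c D u := by
  obtain ⟨Λ, hΛ⟩ : ∃ Λ : ℝ, Λ = 4 * n + 3 + b := ⟨_, rfl⟩
  have hΛ0 : 0 < Λ := by rw [hΛ]; positivity
  obtain ⟨κ, hκ⟩ : ∃ κ : ℝ, κ = 1 / (4 * a * Λ ^ 2) := ⟨_, rfl⟩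
  have hκ0 : 0 < κ := by rw [hκ]; positivity
  have hκs : ∀ s, s ≤ 2 * κ → 2 * a * Λ ^ 2 * s ≤ 1 := fun s hs => by
    calc 2 * a * Λ ^ 2 * s ≤ 2 * a * Λ ^ 2 * (2 * κ) := by gcongr
      _ = 1 := by rw [hκ]; field_simp; norm_num
  have hcpt : IsCompact (closure D) :=
    (isBounded_ball.subset h.subset_ball).isCompact_closure
  obtain ⟨δ₀, hδ₀, hδu⟩ := Metric.uniformContinuousOn_iff_le.1
    (hcpt.uniformContinuousOn_of_continuous hu) κ hκ0
  obtain ⟨δ, hδ⟩ : ∃ δ : ℝ, δ = min δ₀ κ := ⟨_, rfl⟩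
  have hδ0 : 0 < δ := hδ ▸ lt_min hδ₀ hκ0
  have hδκ : δ ≤ κ := hδ ▸ min_le_right _ _
  have hosc : ∀ x₀ ∈ D, ∀ r ≤ δ, ball x₀ r ⊆ D → ∀ x ∈ ball x₀ r, ‖u x - u x₀‖ ≤ κ := by
    intro x₀ hx₀ r hr hrD x hx
    rw [← dist_eq_norm]
    refine hδu x (subset_closure (hrD hx)) x₀ (subset_closure hx₀) ?_
    exact (mem_ball.1 hx).le.trans (hr.trans (hδ ▸ min_le_left _ _))
  refine ⟨Λ * (1 + κ / δ), by positivity, GradientEstimate.of_mul_le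
    (fun x₀ hx₀ => infDist_frontier_pos hn h.isOpen h.subset_ball hx₀) fun x₀ hx₀ => ?_⟩
  have hr0 := infDist_frontier_pos hn h.isOpen h.subset_ball hx₀
  have hr2 := infDist_frontier_le_two hn h.subset_ball hx₀
  have hrD := ball_infDist_frontier_subset h.isOpen hx₀
  set r := infDist x₀ (frontier D)
  have hq : 0 < κ / δ := by positivity
  have hO := oscAt_nonneg (u := u) (x₀ := x₀) r
  rcases le_or_gt r δ with hrδ | hrδ
  · have hOκ : oscAt u x₀ r ≤ κ := by
      refine Real.sSup_le ?_ hκ0.le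
      rintro _ ⟨x, hx, rfl⟩
      exact hosc x₀ hx₀ r hrδ hrD x hx
    refine (h.mul_norm_fderiv_le ha hb hr0 hr2 hrD hO
      (fun x hx => norm_sub_le_oscAt h.mapsTo hx₀ hrD hx) hΛ (hκs _ (by linarith))).trans ?_
    gcongr
    exact le_mul_of_one_le_right hΛ0.le (by linarith)
  · have hδD : ball x₀ δ ⊆ D := (ball_subset_ball hrδ.le).trans hrD
    have h1 := h.mul_norm_fderiv_le ha hb hδ0 (hrδ.le.trans hr2) hδD hκ0.le
      (hosc x₀ hx₀ δ le_rfl hδD) hΛ (hκs _ (by linarith))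
    have h2 : ‖fderiv ℝ u x₀‖ ≤ Λ * (1 + κ / δ) := by
      rw [mul_comm, ← le_div_iff₀ hδ0, mul_div_assoc, add_div, div_self hδ0.ne'] at h1
      exact h1
    calc r * ‖fderiv ℝ u x₀‖ ≤ r * (Λ * (1 + κ / δ)) := by gcongr
      _ = Λ * (1 + κ / δ) * r := mul_comm _ _
      _ ≤ _ := by
        gcongr
        linarith

/-- The gradient estimate with a uniform constant, for a small coefficient `a`. -/
theorem exists_uniform_gradientEstimate (hn : 0 < n) (ha : 0 < a) (ha' : a ≤ 3 / 10) (hb : 0 ≤ b) :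
    ∃ c : ℝ, 0 < c ∧ ∀ (m : ℕ) (D : Set (EuclideanSpace ℝ (Fin n)))
      (u : EuclideanSpace ℝ (Fin n) → EuclideanSpace ℝ (Fin m)),
      PoissonInequality a b D u → GradientEstimate c D u := by
  obtain ⟨Λ, hΛ⟩ : ∃ Λ : ℝ, Λ = 4 * n + 3 + b := ⟨_, rfl⟩
  have hΛ0 : 0 < Λ := by rw [hΛ]; positivity
  obtain ⟨N, hN⟩ : ∃ N : ℝ, N = 1300 * (n + 1) + 40 * b := ⟨_, rfl⟩
  have hN0 : 0 < N := by rw [hN]; positivity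
  refine ⟨Λ + N * (2 * a * Λ ^ 2), by positivity, fun m D u h => GradientEstimate.of_mul_le
    (fun x₀ hx₀ => infDist_frontier_pos hn h.isOpen h.subset_ball hx₀) fun x₀ hx₀ => ?_⟩
  have hr0 := infDist_frontier_pos hn h.isOpen h.subset_ball hx₀
  have hr2 := infDist_frontier_le_two hn h.subset_ball hx₀
  have hrD := ball_infDist_frontier_subset h.isOpen hx₀
  set r := infDist x₀ (frontier D)
  have hO := oscAt_nonneg (u := u) (x₀ := x₀) r
  rcases le_or_gt (2 * a * Λ ^ 2 * (r + oscAt u x₀ r)) 1 with hs | hs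
  · refine (h.mul_norm_fderiv_le ha hb hr0 hr2 hrD hO
      (fun x hx => norm_sub_le_oscAt h.mapsTo hx₀ hrD hx) hΛ hs).trans ?_
    gcongr
    exact le_add_of_nonneg_right (by positivity)
  · have h1 : r * ‖fderiv ℝ u x₀‖ ≤ N := by
      have := mul_norm_fderiv_le_of_small_coeff ha.le ha' hb hr0.le hr2
        (fun x hx => h.contDiffAt (hrD hx))
        (fun x hx => mem_closedBall_zero_iff.1 (h.mapsTo (hrD hx)))
        (fun x hx => h.norm_laplacian_le x (hrD hx))
      simpa [hN] using this
    calc r * ‖fderiv ℝ u x₀‖ ≤ N * 1 := by linarith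
      _ ≤ N * (2 * a * Λ ^ 2 * (r + oscAt u x₀ r)) := by gcongr
      _ ≤ Λ * (r + oscAt u x₀ r) + N * (2 * a * Λ ^ 2 * (r + oscAt u x₀ r)) :=
        le_add_of_nonneg_left (by positivity)
      _ = _ := by ring

end Domain

end

theorem mainTheorem4 (n : ℕ) (hn : 3 ≤ n) (a b α β γ : ℝ)
    (ha : 0 < a) (hb : 0 < b) (hα : 0 < α) (hβ : 0 < β) (hγ : 0 < γ) :
    (∀ (m : ℕ) (D : Set (EuclideanSpace ℝ (Fin n)))
        (u : EuclideanSpace ℝ (Fin n) → EuclideanSpace ℝ (Fin m)),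
        PoissonInequality a b D u → HasAuxiliaryFunction α β γ D u →
        ContinuousOn u (closure D) →
        ∃ c : ℝ, 0 < c ∧ GradientEstimate c D u) ∧
    (a ≤ criticalConst n →
      ∃ c : ℝ, 0 < c ∧
        ∀ (m : ℕ) (D : Set (EuclideanSpace ℝ (Fin n)))
          (u : EuclideanSpace ℝ (Fin n) → EuclideanSpace ℝ (Fin m)),
          PoissonInequality a b D u → HasAuxiliaryFunction α β γ D u →
          GradientEstimate c D u) := by
  have hn0 : 0 < n := by linarith
  refine ⟨fun m D u h _ hu => h.exists_gradientEstimate hn0 ha hb.le hu, fun hac => ?_⟩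
  obtain ⟨c, hc, hest⟩ :=
    exists_uniform_gradientEstimate hn0 ha (hac.trans (criticalConst_le hn)) hb.le
  exact ⟨c, hc, fun m D u h _ => hest m D u h⟩
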